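/- Call a function $f:\mathbb{Z}[i]\to\mathbb{Z}_{\ge 0}$ a Euclidean function if for all $a,b\in\mathbb{Z}[i]$ with $b\neq 0$ there are $q,r\in\mathbb{Z}[i]$ such that $a=qb+r$ and either $r=0$ or $f(r)<f(b)$ (the value $f(0)$ is otherwise unconstrained). Let $\phi_{\mathbb{Z}[i]}$ be the minimal Euclidean function on the Gaussian integers, i.e. $\phi_{\mathbb{Z}[i]}(x)=\min\{f(x): f \text{ a Euclidean function on } \mathbb{Z}[i]\}$ for every $x\in\mathbb{Z}[i]$; in particular $\phi_{\mathbb{Z}[i]}(0)=0$. Theorem. For every integer $k\ge 1$, the set $\phi_{\mathbb{Z}[i]}^{-1}([0,2k+1])$ of Gaussian integers at which $\phi_{\mathbb{Z}[i]}$ takes a value at most $2k+1$ is finite, and $$\left|\phi_{\mathbb{Z}[i]}^{-1}([0,2k+1])\right| = 29+8k-68\cdot 2^k+56\cdot 4^k .$$ -/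

import Mathlib

/-- `f : R → ℕ` is a Euclidean function on `R`: for every `a` and every nonzero `b` one can write
`a = q * b + r` with `r = 0` or `f r < f b`. The value `f 0` plays no role. -/
def IsEuclideanFunction {R : Type*} [CommRing R] (f : R → ℕ) : Prop :=
  ∀ a b : R, b ≠ 0 → ∃ q r : R, a = q * b + r ∧ (r = 0 ∨ f r < f b)

/-- The minimal Euclidean function of a Euclidean domain `R`: the pointwise minimum of all
Euclidean functions on `R`. As the value of a Euclidean function at `0` is unconstrained,
it takes the value `0` at `0`. -/
noncomputable def minimalEuclideanFunction (R : Type*) [CommRing R] (x : R) : ℕ :=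
  sInf {n : ℕ | ∃ f : R → ℕ, IsEuclideanFunction f ∧ f x = n}

/-! Write `w n` for `octagonSize n`. The theorem rests on Lenstra's description of the sublevel
sets: `φ x ≤ n` exactly when `x ∈ octagonTower n`, that is, `x = 0` or `x = (1 + i)^s y` with `s ≤
n` and `y` an odd point of octagon `n - s`.

Lower bound: let `f` be Euclidean and `f b ≤ n + 1`. Divide `(1 + i)^(n+1)` by `b`; by induction the
remainder `r` lies in level `n`. Then `b q = (1 + i)^(n+1) - r` lies in level `n + 1`
(`onePlusI_pow_sub_mem`), and `q ≠ 0` because `(1 + i)^(n+1)` is not in level `n`. Levels are closed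
under nonzero divisors (`mem_octagonTower_of_mul_mem`), so `b` is in level `n + 1`.

Upper bound: the level function is itself Euclidean, since every class modulo a nonzero `b` in level
`n + 1` meets level `n` (`exists_rem_mem_octagonTower`). Even `b` reduces to `b / (1 + i)`. For odd
`b`, take a remainder of least norm; if it is not in level `n`, it is an even point near the
octagon's boundary relative to a common divisor `J` of its coordinates, and a shift by an associate
of `b` gives an odd point of the octagon (`hasNeighbour_of_isShort`).

Counting: level `n + 1` is the disjoint union of the odd points of its octagon and `1 + i` times
level `n`, which gives a recursion for the cardinality. -/

/-! ### Octagons and shifts of short residues -/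

/-- The points `(x, y)` with `|x| ≤ A`, `|y| ≤ A` and `|x| + |y| ≤ B`. -/
def InOctagon (A B x y : ℤ) : Prop :=
  x ≤ A ∧ -x ≤ A ∧ y ≤ A ∧ -y ≤ A ∧ x + y ≤ B ∧ x - y ≤ B ∧ -x + y ≤ B ∧ -x - y ≤ B

namespace InOctagon

variable {A B x y : ℤ}

theorem rotate : InOctagon A B (-y) x ↔ InOctagon A B x y := by
  unfold InOctagon; omega

theorem conj : InOctagon A B x (-y) ↔ InOctagon A B x y := by
  unfold InOctagon; omega

end InOctagon

/-- The sizes `3, 4, 6, 8, 12, 16, …` of Lenstra's octagons. -/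
def octagonSize : ℕ → ℤ
  | 0 => 3
  | 1 => 4
  | n + 2 => 2 * octagonSize n

/-- Consecutive sizes are in ratio 3:4 or 2:3. With their difference `D` as unit, the octagon
inequalities have numerical coefficients, within reach of `omega`. -/
theorem octagonSize_cases (n : ℕ) : ∃ D : ℤ, 0 < D ∧
    (octagonSize n = 3 * D ∧ octagonSize (n + 1) = 4 * D ∨
      octagonSize n = 2 * D ∧ octagonSize (n + 1) = 3 * D ∧ D % 2 = 0) := by
  induction n with
  | zero => exact ⟨1, by norm_num, Or.inl ⟨rfl, rfl⟩⟩
  | succ n ih =>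
    have h2 : octagonSize (n + 1 + 1) = 2 * octagonSize n := rfl
    obtain ⟨D, hD, ⟨h, h'⟩ | ⟨h, h', -⟩⟩ := ih
    · exact ⟨2 * D, by omega, Or.inr ⟨by omega, by omega, by omega⟩⟩
    · exact ⟨D, hD, Or.inl ⟨by omega, by omega⟩⟩

theorem octagonSize_add_two (n : ℕ) : octagonSize (n + 1 + 1) = 2 * octagonSize n := rfl

/-- The lattice points of the `n`-th octagon. -/
def octagon (n : ℕ) : Set GaussianInt :=
  {z | InOctagon (octagonSize n - 2) (octagonSize (n + 1) - 3) z.re z.im}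

/-- Some point of a residue class modulo an odd `p + q i`, close to `x + y i`, lies in the octagon:
the case `0 ≤ q < p`, `|y| ≤ x`. -/
theorem inOctagon_sub_of_sector {D W W' J p q x y : ℤ}
    (hW : W = 3 * D ∧ W' = 4 * D ∨ W = 2 * D ∧ W' = 3 * D ∧ D % 2 = 0)
    (hJ : 0 < J) (hD : 0 < D) (hJD : J ∣ D) (hJx : J ∣ x) (hJy : J ∣ y)
    (hq : 0 ≤ q) (hqp : q < p) (hp : p ≤ W' - 2) (hpq : p + q ≤ 2 * W - 3)
    (hodd : (p + q) % 2 = 1) (hyx : y ≤ x) (hyx' : -y ≤ x) (heven : (x + y) % 2 = 0)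
    (hx : x ≤ W - 2) (hxpq : 2 * x < p + q) (hxy : x + y ≤ W' - 3) (hxy' : x - y ≤ W' - 3)
    (hbad : ¬ InOctagon (W - 2 * J) (W' - 3 * J) x y) :
    InOctagon (W - 2) (W' - 3) (x - p) (y - q) ∨
      InOctagon (W - 2) (W' - 3) (x - q) (y + p) := by
  have key : ∀ a : ℤ, J ∣ a → -J < a → 0 ≤ a := fun a ha h => by
    obtain ⟨c, rfl⟩ := ha
    have : -1 < c := by nlinarith
    nlinarith
  have hJW : J ∣ W := by
    rcases hW with h | h
    · rw [h.1]; exact hJD.mul_left _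
    · rw [h.1]; exact hJD.mul_left _
  have hJW' : J ∣ W' := by
    rcases hW with h | h
    · rw [h.2]; exact hJD.mul_left _
    · rw [h.2.1]; exact hJD.mul_left _
  have hJle : J ≤ D := Int.le_of_dvd hD hJD
  have hJ2 : J = D ∨ 2 * J ≤ D := by
    obtain ⟨c, rfl⟩ := hJD
    have : 0 < c := by nlinarith
    rcases (show c = 1 ∨ 2 ≤ c by omega) with rfl | h
    · simp
    · right; nlinarith
  -- Since `x`, `y`, `W`, `W'` are multiples of `J`, a strict violation of a shrunk side already
  -- reaches the next multiple of `J`.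
  have k1 := key (x - W + J) (((hJx.sub hJW)).add dvd_rfl)
  have k2 := key (x + y - W' + 2 * J) ((((hJx.add hJy).sub hJW')).add (dvd_mul_left _ _))
  have k3 := key (x - y - W' + 2 * J) ((((hJx.sub hJy).sub hJW')).add (dvd_mul_left _ _))
  have k4 := key (W' - W - J + y) ((((hJW'.sub hJW)).sub dvd_rfl).add hJy)
  have k5 := key (x - J) (hJx.sub dvd_rfl)
  have hbad' : 0 ≤ x - W + J ∨ 0 ≤ x + y - W' + 2 * J ∨ 0 ≤ x - y - W' + 2 * J := by
    unfold InOctagon at hbad; omega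
  clear hbad key hJD hJx hJy hJW hJW' k2 k3
  by_cases hy : 0 ≤ y
  · left
    unfold InOctagon
    rcases hW with ⟨rfl, rfl⟩ | ⟨rfl, rfl, h⟩ <;> rcases hJ2 with rfl | hJ2 <;>
      rcases hbad' with h' | h' | h' <;> refine ⟨?_, ?_, ?_, ?_, ?_, ?_, ?_, ?_⟩ <;> omega
  · unfold InOctagon
    rcases hW with ⟨rfl, rfl⟩ | ⟨rfl, rfl, h⟩ <;> rcases hJ2 with rfl | hJ2 <;>
      rcases hbad' with h' | h' | h' <;> omega

/-- The inequalities that hold when `x + y i` has minimal norm in its class modulo `p + q i`. -/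
def IsShort (p q x y : ℤ) : Prop :=
  2 * (x * p + y * q) ≤ p ^ 2 + q ^ 2 ∧ -(2 * (x * p + y * q)) ≤ p ^ 2 + q ^ 2 ∧
    2 * (y * p - x * q) ≤ p ^ 2 + q ^ 2 ∧ -(2 * (y * p - x * q)) ≤ p ^ 2 + q ^ 2

/-- Short points fill the square with vertices `(±1 ± i)(p + q i) / 2`, on which `x` is at most `(p
+ q) / 2` and `x ± y` at most `p`. The inequalities are strict because the norm `p ^ 2 + q ^ 2` is
odd. -/
theorem IsShort.bounds {p q x y : ℤ} (h : IsShort p q x y) (hq : 0 ≤ q) (hqp : q < p)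
    (hodd : (p + q) % 2 = 1) : 2 * x < p + q ∧ x + y < p ∧ x - y < p := by
  obtain ⟨h1, h2, h3, h4⟩ := h
  have hN : (p ^ 2 + q ^ 2) % 2 = 1 := by
    rcases Int.emod_two_eq_zero_or_one p with h | h <;>
      rcases Int.emod_two_eq_zero_or_one q with h' | h' <;>
      simp [pow_two, Int.add_emod, Int.mul_emod, h, h'] at hodd ⊢
  have h1' : 2 * (x * p + y * q) ≤ p ^ 2 + q ^ 2 - 1 := by omega
  have h3' : 2 * (y * p - x * q) ≤ p ^ 2 + q ^ 2 - 1 := by omega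
  have h4' : -(2 * (y * p - x * q)) ≤ p ^ 2 + q ^ 2 - 1 := by omega
  have hN0 : 0 < p ^ 2 + q ^ 2 := by nlinarith
  refine ⟨?_, ?_, ?_⟩
  · have a := mul_le_mul_of_nonneg_left h1' (show 0 ≤ p by omega)
    have b := mul_le_mul_of_nonneg_left h4' hq
    by_contra hc
    have c := mul_le_mul_of_nonneg_right (show p + q ≤ 2 * x by omega) hN0.le
    nlinarith
  · have a := mul_le_mul_of_nonneg_left h1' (show 0 ≤ p + q by omega)
    have b := mul_le_mul_of_nonneg_left h3' (show 0 ≤ p - q by omega)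
    by_contra hc
    have c := mul_le_mul_of_nonneg_right (show p ≤ x + y by omega) hN0.le
    nlinarith
  · have a := mul_le_mul_of_nonneg_left h1' (show 0 ≤ p - q by omega)
    have b := mul_le_mul_of_nonneg_left h4' (show 0 ≤ p + q by omega)
    by_contra hc
    have c := mul_le_mul_of_nonneg_right (show p ≤ x - y by omega) hN0.le
    nlinarith

/-- The point `x + y i` is even and one of the four points obtained from it by subtracting an
associate of `p + q i` lies in the octagon. -/
def HasNeighbour (A B p q x y : ℤ) : Prop :=
  (x + y) % 2 = 0 ∧
    (InOctagon A B (x - p) (y - q) ∨ InOctagon A B (x + q) (y - p) ∨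
      InOctagon A B (x + p) (y + q) ∨ InOctagon A B (x - q) (y + p))

namespace HasNeighbour

variable {A B p q x y : ℤ}

theorem rotate_left (h : HasNeighbour A B (-q) p x y) : HasNeighbour A B p q x y := by
  unfold HasNeighbour at h ⊢
  simp only [sub_neg_eq_add, ← sub_eq_add_neg] at h
  tauto

theorem rotate_right (h : HasNeighbour A B p q (-y) x) : HasNeighbour A B p q x y := by
  obtain ⟨he, h⟩ := h
  refine ⟨by omega, ?_⟩
  have e1 : -y - p = -(y + p) := by ring
  have e2 : -y + q = -(y - q) := by ring
  have e3 : -y + p = -(y - p) := by ring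
  have e4 : -y - q = -(y + q) := by ring
  rw [e1, e2, e3, e4] at h
  simp only [InOctagon.rotate] at h
  tauto

theorem conj (h : HasNeighbour A B p (-q) x (-y)) : HasNeighbour A B p q x y := by
  obtain ⟨he, h⟩ := h
  refine ⟨by omega, ?_⟩
  have e1 : -y - -q = -(y - q) := by ring
  have e2 : -y - p = -(y + p) := by ring
  have e3 : -y + -q = -(y + q) := by ring
  have e4 : -y + p = -(y - p) := by ring
  rw [e1, e2, e3, e4] at h
  simp only [InOctagon.conj, sub_neg_eq_add, ← sub_eq_add_neg] at h
  tauto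

end HasNeighbour

/-- If `x + y i` is short modulo the odd number `p + q i` of level `n + 1`, and outside an octagon
shrunk by multiples of a common divisor `J`, then shifting it by an associate of `p + q i` leads
into the `n`-th octagon. -/
theorem hasNeighbour_of_isShort {n : ℕ} {J p q x y : ℤ} (hJ : 0 < J)
    (hJD : J ∣ octagonSize (n + 1) - octagonSize n) (hJx : J ∣ x) (hJy : J ∣ y)
    (hpq : InOctagon (octagonSize (n + 1) - 2) (octagonSize (n + 1 + 1) - 3) p q)
    (hodd : (p + q) % 2 = 1)
    (heven : InOctagon (octagonSize n - 2) (octagonSize (n + 1) - 3) x y → (x + y) % 2 = 0)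
    (hshort : IsShort p q x y)
    (hbad : ¬ InOctagon (octagonSize n - 2 * J) (octagonSize (n + 1) - 3 * J) x y) :
    HasNeighbour (octagonSize n - 2) (octagonSize (n + 1) - 3) p q x y := by
  obtain ⟨D, hD, hW⟩ := octagonSize_cases n
  have hJD' : J ∣ D := by
    rcases hW with h | h
    · rwa [h.1, h.2, show 4 * D - 3 * D = D by ring] at hJD
    · rwa [h.1, h.2.1, show 3 * D - 2 * D = D by ring] at hJD
  clear hJD
  rw [octagonSize_add_two] at hpq
  generalize octagonSize n = W at *
  generalize octagonSize (n + 1) = W' at *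
  -- The symmetries of the octagon reduce everything to this sector: quarter turns of `x + y i` give
  -- `|y| ≤ x`, conjugating both numbers gives `0 ≤ q`, and quarter turns of `p + q i` give `|q| <
  -- p`, strict because `p + q` is odd.
  have sector : ∀ p q x y : ℤ, J ∣ x → J ∣ y → InOctagon (W' - 2) (2 * W - 3) p q →
      (p + q) % 2 = 1 → (InOctagon (W - 2) (W' - 3) x y → (x + y) % 2 = 0) → IsShort p q x y →
      ¬ InOctagon (W - 2 * J) (W' - 3 * J) x y → 0 ≤ q → q < p → y ≤ x → -y ≤ x →
      HasNeighbour (W - 2) (W' - 3) p q x y := by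
    intro p q x y hJx hJy hpq hodd heven hshort hbad hq hqp hyx hyx'
    obtain ⟨b1, b2, b3⟩ := hshort.bounds hq hqp hodd
    obtain ⟨h1, -, -, -, h2, -⟩ := hpq
    -- The bounds on short points already place `x + y i` in the octagon.
    have he := heven (by unfold InOctagon; omega)
    refine ⟨he, ?_⟩
    rcases inOctagon_sub_of_sector hW hJ hD hJD' hJx hJy hq hqp h1 h2 hodd hyx hyx' he
      (by omega) b1 (by omega) (by omega) hbad with h | h
    · exact Or.inl h
    · exact Or.inr (Or.inr (Or.inr h))
  have step : ∀ p q x y : ℤ, J ∣ x → J ∣ y → InOctagon (W' - 2) (2 * W - 3) p q →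
      (p + q) % 2 = 1 → (InOctagon (W - 2) (W' - 3) x y → (x + y) % 2 = 0) → IsShort p q x y →
      ¬ InOctagon (W - 2 * J) (W' - 3 * J) x y → 0 ≤ q → q < p →
      HasNeighbour (W - 2) (W' - 3) p q x y := by
    intro p q x y hJx hJy hpq hodd heven hshort hbad hq hqp
    have hJx' := hJx.neg_right
    have hJy' := hJy.neg_right
    have s1 : IsShort p q (-y) x := by
      unfold IsShort at hshort ⊢
      refine ⟨?_, ?_, ?_, ?_⟩ <;> nlinarith
    have s2 : IsShort p q (-x) (-y) := by
      unfold IsShort at hshort ⊢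
      refine ⟨?_, ?_, ?_, ?_⟩ <;> nlinarith
    have s3 : IsShort p q y (-x) := by
      unfold IsShort at hshort ⊢
      refine ⟨?_, ?_, ?_, ?_⟩ <;> nlinarith
    have b1 : ¬ InOctagon (W - 2 * J) (W' - 3 * J) (-y) x := by rwa [InOctagon.rotate]
    have b2 : ¬ InOctagon (W - 2 * J) (W' - 3 * J) (-x) (-y) := by rwa [InOctagon.rotate]
    have b3 : ¬ InOctagon (W - 2 * J) (W' - 3 * J) y (-x) := by
      rw [← neg_neg y]; rwa [InOctagon.rotate]
    have e1 : InOctagon (W - 2) (W' - 3) (-y) x → (-y + x) % 2 = 0 := fun h => by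
      have := heven (InOctagon.rotate.1 h); omega
    have e2 : InOctagon (W - 2) (W' - 3) (-x) (-y) → (-x + -y) % 2 = 0 := fun h => by
      have := e1 (InOctagon.rotate.1 h); omega
    have e3 : InOctagon (W - 2) (W' - 3) y (-x) → (y + -x) % 2 = 0 := fun h => by
      rw [← neg_neg y] at h
      have := e2 (InOctagon.rotate.1 h); omega
    rcases (show (y ≤ x ∧ -y ≤ x) ∨ (x ≤ -y ∧ -x ≤ -y) ∨ (-y ≤ -x ∧ - -y ≤ -x) ∨
      (-x ≤ y ∧ - -x ≤ y) by omega) with h | h | h | h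
    · exact sector p q x y hJx hJy hpq hodd heven hshort hbad hq hqp h.1 h.2
    · exact (sector p q (-y) x hJy' hJx hpq hodd e1 s1 b1 hq hqp h.1 h.2).rotate_right
    · exact (sector p q (-x) (-y) hJx' hJy' hpq hodd e2 s2 b2 hq hqp
        h.1 h.2).rotate_right.rotate_right
    · have := sector p q y (-x) hJy hJx' hpq hodd e3 s3 b3 hq hqp h.1 h.2
      rw [← neg_neg y] at this
      exact this.rotate_right.rotate_right.rotate_right
  have step' : ∀ p q x y : ℤ, J ∣ x → J ∣ y → InOctagon (W' - 2) (2 * W - 3) p q →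
      (p + q) % 2 = 1 → (InOctagon (W - 2) (W' - 3) x y → (x + y) % 2 = 0) → IsShort p q x y →
      ¬ InOctagon (W - 2 * J) (W' - 3 * J) x y → q < p → -q < p →
      HasNeighbour (W - 2) (W' - 3) p q x y := by
    intro p q x y hJx hJy hpq hodd heven hshort hbad hq hqp
    by_cases h0 : 0 ≤ q
    · exact step p q x y hJx hJy hpq hodd heven hshort hbad h0 hq
    · refine (step p (-q) x (-y) hJx hJy.neg_right (InOctagon.conj.2 hpq) (by omega)
        (fun h => by have := heven (InOctagon.conj.1 h); omega) ?_
        (by rwa [InOctagon.conj]) (by omega) hqp).conj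
      unfold IsShort at hshort ⊢
      refine ⟨?_, ?_, ?_, ?_⟩ <;> nlinarith
  have s1 : IsShort (-q) p x y := by
    unfold IsShort at hshort ⊢
    refine ⟨?_, ?_, ?_, ?_⟩ <;> nlinarith
  have s2 : IsShort (-p) (-q) x y := by
    unfold IsShort at hshort ⊢
    refine ⟨?_, ?_, ?_, ?_⟩ <;> nlinarith
  have s3 : IsShort (- -q) (-p) x y := by
    unfold IsShort at hshort ⊢
    refine ⟨?_, ?_, ?_, ?_⟩ <;> nlinarith
  have o1 := InOctagon.rotate.2 hpq
  have o2 := InOctagon.rotate.2 o1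
  have o3 := InOctagon.rotate.2 o2
  rcases (show (q < p ∧ -q < p) ∨ (p < -q ∧ -p < -q) ∨ (-q < -p ∧ - -q < -p) ∨
      (-p < - -q ∧ - -p < - -q) by omega) with h | h | h | h
  · exact step' p q x y hJx hJy hpq hodd heven hshort hbad h.1 h.2
  · exact (step' (-q) p x y hJx hJy o1 (by omega) heven s1 hbad h.1 h.2).rotate_left
  · exact (step' (-p) (-q) x y hJx hJy o2 (by omega) heven s2 hbad
      h.1 h.2).rotate_left.rotate_left
  · exact (step' (- -q) (-p) x y hJx hJy o3 (by omega) heven s3 hbad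
      h.1 h.2).rotate_left.rotate_left.rotate_left

/-! ### Parity and the tower of octagons -/

/-- The Gaussian integer `1 + i`. -/
def onePlusI : GaussianInt := ⟨1, 1⟩

/-- A Gaussian integer is odd if it is not divisible by `1 + i`. -/
def IsOddGaussian (z : GaussianInt) : Prop := (z.re + z.im) % 2 = 1

theorem onePlusI_mul_re (z : GaussianInt) : (onePlusI * z).re = z.re - z.im := by
  simp [onePlusI, Zsqrtd.re_mul, sub_eq_add_neg]

theorem onePlusI_mul_im (z : GaussianInt) : (onePlusI * z).im = z.re + z.im := by
  simp [onePlusI, Zsqrtd.im_mul]; ring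

theorem onePlusI_ne_zero : onePlusI ≠ 0 := fun h => by
  simpa [onePlusI] using congrArg Zsqrtd.re h

theorem onePlusI_mul_not_isOdd (z : GaussianInt) : ¬ IsOddGaussian (onePlusI * z) := by
  unfold IsOddGaussian; rw [onePlusI_mul_re, onePlusI_mul_im]; omega

theorem exists_eq_onePlusI_mul {z : GaussianInt} (h : ¬ IsOddGaussian z) :
    ∃ y, z = onePlusI * y := by
  unfold IsOddGaussian at h
  refine ⟨⟨(z.re + z.im) / 2, (z.im - z.re) / 2⟩, ?_⟩
  apply Zsqrtd.ext
  · rw [onePlusI_mul_re]; dsimp only; omega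
  · rw [onePlusI_mul_im]; dsimp only; omega

theorem IsOddGaussian.mul_iff {a b : GaussianInt} :
    IsOddGaussian (a * b) ↔ IsOddGaussian a ∧ IsOddGaussian b := by
  unfold IsOddGaussian
  rw [Zsqrtd.re_mul, Zsqrtd.im_mul]
  have : (a.re * b.re + -1 * a.im * b.im + (a.re * b.im + a.im * b.re)) =
    (a.re + a.im) * (b.re + b.im) + 2 * (-(a.im * b.im)) := by ring
  rw [this, Int.add_mul_emod_self_left, Int.mul_emod]
  rcases Int.emod_two_eq_zero_or_one (a.re + a.im) with h | h <;>
    rcases Int.emod_two_eq_zero_or_one (b.re + b.im) with h' | h' <;> simp [h, h']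

/-- The set of Gaussian integers `(1 + i) ^ s * y` with `s ≤ n` and `y` an odd point of the
`(n - s)`-th octagon, together with `0`. -/
def octagonTower : ℕ → Set GaussianInt
  | 0 => insert 0 {z | IsOddGaussian z ∧ z ∈ octagon 0}
  | n + 1 => {z | IsOddGaussian z ∧ z ∈ octagon (n + 1)} ∪ (onePlusI * ·) '' octagonTower n

theorem zero_mem_octagonTower (n : ℕ) : (0 : GaussianInt) ∈ octagonTower n := by
  induction n with
  | zero => exact Or.inl rfl
  | succ n ih => exact Or.inr ⟨0, ih, mul_zero _⟩

theorem zero_not_isOdd : ¬ IsOddGaussian 0 := by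
  simp [IsOddGaussian]

theorem IsOddGaussian.mem_octagonTower_iff {n : ℕ} {z : GaussianInt} (h : IsOddGaussian z) :
    z ∈ octagonTower n ↔ z ∈ octagon n := by
  cases n with
  | zero =>
    refine ⟨?_, fun hz => Or.inr ⟨h, hz⟩⟩
    rintro (rfl | hz)
    · exact absurd h zero_not_isOdd
    · exact hz.2
  | succ n =>
    refine ⟨?_, fun hz => Or.inl ⟨h, hz⟩⟩
    rintro (hz | ⟨y, -, rfl⟩)
    · exact hz.2
    · exact absurd h (onePlusI_mul_not_isOdd y)

theorem onePlusI_mul_mem_succ {n : ℕ} {z : GaussianInt} :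
    onePlusI * z ∈ octagonTower (n + 1) ↔ z ∈ octagonTower n := by
  refine ⟨?_, fun h => Or.inr ⟨z, h, rfl⟩⟩
  rintro (h | ⟨y, hy, h⟩)
  · exact absurd h.1 (onePlusI_mul_not_isOdd z)
  · rwa [← mul_left_cancel₀ onePlusI_ne_zero h]

theorem onePlusI_mul_mem_zero {z : GaussianInt} : onePlusI * z ∈ octagonTower 0 ↔ z = 0 := by
  refine ⟨?_, fun h => by rw [h, mul_zero]; exact zero_mem_octagonTower 0⟩
  rintro (h | h)
  · exact (mul_eq_zero.1 h).resolve_left onePlusI_ne_zero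
  · exact absurd h.1 (onePlusI_mul_not_isOdd z)

theorem octagon_subset_succ (n : ℕ) : octagon n ⊆ octagon (n + 1) := by
  intro z hz
  obtain ⟨D, hD, h⟩ := octagonSize_cases n
  have h2 := octagonSize_add_two n
  simp only [octagon, InOctagon, Set.mem_ofPred_eq] at hz ⊢
  rcases h with h | h <;> omega

theorem octagonTower_subset_succ (n : ℕ) : octagonTower n ⊆ octagonTower (n + 1) := by
  induction n with
  | zero =>
    rintro z (rfl | h)
    · exact zero_mem_octagonTower 1
    · exact Or.inl ⟨h.1, octagon_subset_succ 0 h.2⟩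
  | succ n ih =>
    rintro z (h | ⟨y, hy, rfl⟩)
    · exact Or.inl ⟨h.1, octagon_subset_succ _ h.2⟩
    · exact Or.inr ⟨y, ih hy, rfl⟩

/-- Adding a unit to `(1 + i) c`, where `c` lies in an octagon, leads into the next octagon. -/
theorem onePlusI_mul_add_mem_octagon {n : ℕ} {c u : GaussianInt} (hc : c ∈ octagon n)
    (hu : InOctagon 1 1 u.re u.im) : onePlusI * c + u ∈ octagon (n + 1) := by
  have h2 := octagonSize_add_two n
  simp only [octagon, InOctagon, Set.mem_ofPred_eq, Zsqrtd.re_add, Zsqrtd.im_add,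
    onePlusI_mul_re, onePlusI_mul_im] at hc hu ⊢
  omega

theorem octagonTower_subset_octagon (n : ℕ) : octagonTower n ⊆ octagon n := by
  induction n with
  | zero =>
    rintro z (rfl | h)
    · simp [octagon, InOctagon, octagonSize]
    · exact h.2
  | succ n ih =>
    rintro z (h | ⟨y, hy, rfl⟩)
    · exact h.2
    · simpa using onePlusI_mul_add_mem_octagon (u := 0) (ih hy) (by simp [InOctagon])

/-- If `z` does not lie in the tower, then it is divisible by an integer `J` such that `z` is
outside an octagon shrunk by multiples of `J`. -/
theorem exists_dvd_not_inOctagon {n : ℕ} {z : GaussianInt} (hz : z ∉ octagonTower n) :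
    ∃ J : ℤ, 0 < J ∧ J ∣ octagonSize (n + 1) - octagonSize n ∧ J ∣ z.re ∧ J ∣ z.im ∧
      ¬ InOctagon (octagonSize n - 2 * J) (octagonSize (n + 1) - 3 * J) z.re z.im := by
  by_cases ho : z ∈ octagon n
  swap
  · exact ⟨1, one_pos, one_dvd _, one_dvd _, one_dvd _, ho⟩
  have hodd : ¬ IsOddGaussian z := fun h => hz (h.mem_octagonTower_iff.2 ho)
  obtain ⟨y, rfl⟩ := exists_eq_onePlusI_mul hodd
  have hne : y ≠ 0 := by
    rintro rfl
    exact hz (by rw [mul_zero]; exact zero_mem_octagonTower n)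
  -- For odd `y`, the point `(1 + i) y` of octagon `n` forces `y` into octagon `n - 1`: `w n` is
  -- even for `n ≥ 1`, so parity improves the bound `w n - 2` on `|re ± im|` to `w n - 3`.
  have hodd' : ¬ IsOddGaussian y := by
    intro h
    apply hz
    simp only [octagon, InOctagon, Set.mem_ofPred_eq, onePlusI_mul_re, onePlusI_mul_im] at ho
    cases n with
    | zero =>
      exfalso
      simp only [octagonSize] at ho
      unfold IsOddGaussian at h
      omega
    | succ n =>
      rw [onePlusI_mul_mem_succ, h.mem_octagonTower_iff]
      obtain ⟨D, hD, h'⟩ := octagonSize_cases n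
      have h2 := octagonSize_add_two n
      simp only [octagon, InOctagon, Set.mem_ofPred_eq]
      unfold IsOddGaussian at h
      rcases h' with h' | h' <;> omega
  obtain ⟨x, rfl⟩ := exists_eq_onePlusI_mul hodd'
  have hne' : x ≠ 0 := by
    rintro rfl
    exact hne (mul_zero _)
  simp only [onePlusI_mul_re, onePlusI_mul_im]
  simp only [octagon, Set.mem_ofPred_eq, onePlusI_mul_re, onePlusI_mul_im] at ho
  match n, hz, ho with
  | 0, hz, ho =>
    exfalso
    simp only [octagonSize, InOctagon] at ho
    exact hne' (Zsqrtd.ext (by simp; omega) (by simp; omega))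
  | 1, hz, ho =>
    -- For `J = 2` the shrunk octagon is the origin alone: `4 - 2 * 2 = 6 - 3 * 2 = 0`.
    refine ⟨2, two_pos, by decide, by omega, by omega, fun h => hne' ?_⟩
    simp only [octagonSize, InOctagon] at h
    exact Zsqrtd.ext (by simp; omega) (by simp; omega)
  | n + 2, hz, ho =>
    -- Here `z = (1 + i)^2 x = 2 i x`, and sizes double every two levels, so `J` doubles as well.
    rw [onePlusI_mul_mem_succ, onePlusI_mul_mem_succ] at hz
    obtain ⟨J, hJ, hD, hre, him, h⟩ := exists_dvd_not_inOctagon hz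
    have h2 : octagonSize (n + 2) = 2 * octagonSize n := rfl
    have h3 : octagonSize (n + 2 + 1) = 2 * octagonSize (n + 1) := rfl
    refine ⟨2 * J, by omega, ?_, ?_, ?_, ?_⟩
    · rw [h2, h3, ← mul_sub]
      exact mul_dvd_mul_left 2 hD
    · rw [show x.re - x.im - (x.re + x.im) = 2 * -x.im by ring]
      exact mul_dvd_mul_left 2 him.neg_right
    · rw [show x.re - x.im + (x.re + x.im) = 2 * x.re by ring]
      exact mul_dvd_mul_left 2 hre
    · unfold InOctagon at h ⊢
      rw [h2, h3]
      omega

theorem exists_mem_octagonTower (z : GaussianInt) : ∃ n, z ∈ octagonTower n := by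
  have hodd : ∀ z, IsOddGaussian z → ∃ n, z ∈ octagonTower n := by
    intro z hz
    have hw : ∀ n : ℕ, (n : ℤ) + 3 ≤ octagonSize n ∧ (n : ℤ) + 4 ≤ octagonSize (n + 1) := by
      intro n
      induction n with
      | zero => simp [octagonSize]
      | succ n ih =>
        have h2 := octagonSize_add_two n
        push_cast
        omega
    refine ⟨z.re.natAbs + z.im.natAbs, hz.mem_octagonTower_iff.2 ?_⟩
    have := hw (z.re.natAbs + z.im.natAbs)
    simp only [octagon, InOctagon, Set.mem_ofPred_eq]
    omega
  induction h : z.norm.natAbs using Nat.strong_induction_on generalizing z with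
  | _ N ih =>
    by_cases hz : IsOddGaussian z
    · exact hodd z hz
    · obtain ⟨y, rfl⟩ := exists_eq_onePlusI_mul hz
      by_cases hy : y = 0
      · exact ⟨0, by rw [hy, mul_zero]; exact zero_mem_octagonTower 0⟩
      · have hy' : 0 < y.norm.natAbs := Int.natAbs_pos.2 fun h =>
          hy ((GaussianInt.norm_eq_zero).1 h)
        have : (onePlusI * y).norm.natAbs = 2 * y.norm.natAbs := by
          rw [Zsqrtd.norm_mul, Int.natAbs_mul]; rfl
        obtain ⟨n, hn⟩ := ih y.norm.natAbs (by omega) y rfl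
        exact ⟨n + 1, onePlusI_mul_mem_succ.2 hn⟩

/-! ### Lower bound for Euclidean functions -/

/-- The bounds are exactly the gaps between the sides of octagons `n` and `n + 1`, so `(1 +
i)^(n+1)` minus a point of the former lies in the latter. -/
theorem onePlusI_pow_inOctagon (n : ℕ) :
    InOctagon (octagonSize (n + 1) - octagonSize n) (octagonSize (n + 1 + 1) - octagonSize (n + 1))
      (onePlusI ^ (n + 1)).re (onePlusI ^ (n + 1)).im := by
  induction n with
  | zero => simp [onePlusI, InOctagon, octagonSize]
  | succ n ih =>
    have h2 := octagonSize_add_two n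
    have h3 := octagonSize_add_two (n + 1)
    rw [pow_succ', onePlusI_mul_re, onePlusI_mul_im]
    unfold InOctagon at ih ⊢
    omega

/-- Subtracting from `(1 + i) ^ (n + 1)` an element of level `n` gives an element of level
`n + 1`. -/
theorem onePlusI_pow_sub_mem {n : ℕ} {r : GaussianInt} (hr : r ∈ octagonTower n) :
    onePlusI ^ (n + 1) - r ∈ octagonTower (n + 1) := by
  have hodd : ∀ (n : ℕ) (r : GaussianInt), IsOddGaussian r → r ∈ octagonTower n →
      onePlusI ^ (n + 1) - r ∈ octagonTower (n + 1) := by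
    intro n r h hr
    have hpow := onePlusI_mul_not_isOdd (onePlusI ^ n)
    rw [← pow_succ'] at hpow
    rw [h.mem_octagonTower_iff] at hr
    refine (IsOddGaussian.mem_octagonTower_iff ?_).2 ?_
    · unfold IsOddGaussian at hpow h ⊢
      rw [Zsqrtd.re_sub, Zsqrtd.im_sub]
      omega
    · have := onePlusI_pow_inOctagon n
      simp only [octagon, InOctagon, Set.mem_ofPred_eq, Zsqrtd.re_sub, Zsqrtd.im_sub] at this hr ⊢
      omega
  by_cases h : IsOddGaussian r
  · exact hodd n r h hr
  obtain ⟨s, rfl⟩ := exists_eq_onePlusI_mul h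
  rw [pow_succ', ← mul_sub, onePlusI_mul_mem_succ]
  cases n with
  | zero =>
    rw [onePlusI_mul_mem_zero.1 hr, pow_zero, sub_zero]
    exact Or.inr ⟨by simp [IsOddGaussian], by simp [octagon, InOctagon, octagonSize]⟩
  | succ n => exact onePlusI_pow_sub_mem (onePlusI_mul_mem_succ.1 hr)

theorem onePlusI_pow_not_mem (n : ℕ) : onePlusI ^ (n + 1) ∉ octagonTower n := by
  induction n with
  | zero =>
    rw [pow_succ', onePlusI_mul_mem_zero]
    simp
  | succ n ih =>
    rwa [pow_succ', onePlusI_mul_mem_succ]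

theorem isOddGaussian_iff_norm {z : GaussianInt} : IsOddGaussian z ↔ z.norm % 2 = 1 := by
  unfold IsOddGaussian
  rw [Zsqrtd.norm_def]
  rcases Int.emod_two_eq_zero_or_one z.re with h | h <;>
    rcases Int.emod_two_eq_zero_or_one z.im with h' | h' <;>
    simp [Int.add_emod, Int.mul_emod, h, h']

/-- An octagon contains every divisor of its points, provided the cofactor is odd. -/
theorem mem_octagon_of_mul_mem {n : ℕ} {b d : GaussianInt} (hd : IsOddGaussian d)
    (h : b * d ∈ octagon n) : b ∈ octagon n := by
  have hd0 : 0 < d.norm := by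
    refine lt_of_le_of_ne (GaussianInt.norm_nonneg d) fun h => ?_
    rw [isOddGaussian_iff_norm, ← h] at hd
    omega
  have hd1 := isOddGaussian_iff_norm.1 hd
  -- Units preserve the octagon. Otherwise norms are compared: points of the octagon have norm at
  -- most `2 (W - 2)^2`, less than three times the least norm possible outside it.
  rcases (show d.norm = 1 ∨ 3 ≤ d.norm by omega) with h1 | h2
  · have h1' : d.re * d.re + d.im * d.im = 1 := by
      rw [Zsqrtd.norm_def] at h1; linarith
    have a1 : -1 ≤ d.re := by nlinarith
    have a2 : d.re ≤ 1 := by nlinarith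
    have a3 : -1 ≤ d.im := by nlinarith
    have a4 : d.im ≤ 1 := by nlinarith
    simp only [octagon, InOctagon, Set.mem_ofPred_eq, Zsqrtd.re_mul, Zsqrtd.im_mul] at h ⊢
    generalize d.re = u at *
    generalize d.im = v at *
    interval_cases u <;> interval_cases v <;> omega
  · have hmul : (b * d).norm = b.norm * d.norm := Zsqrtd.norm_mul b d
    have hb0 : 0 ≤ b.norm := GaussianInt.norm_nonneg b
    have hle : 3 * b.norm ≤ (b * d).norm := by nlinarith
    clear hmul
    rw [Zsqrtd.norm_def, Zsqrtd.norm_def] at hle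
    generalize b * d = z at *
    obtain ⟨D, hD, hW⟩ := octagonSize_cases n
    by_contra hb
    simp only [octagon, InOctagon, Set.mem_ofPred_eq] at h hb
    generalize octagonSize n = W at *
    generalize octagonSize (n + 1) = W' at *
    have hM : 0 ≤ W - 2 := by omega
    have hz1 : z.re ^ 2 ≤ (W - 2) ^ 2 := sq_le_sq' (by omega) (by omega)
    have hz2 : z.im ^ 2 ≤ (W - 2) ^ 2 := sq_le_sq' (by omega) (by omega)
    have hlow : (W - 1) ^ 2 ≤ b.re ^ 2 + b.im ^ 2 ∨
        (W' - 2) ^ 2 ≤ 2 * (b.re ^ 2 + b.im ^ 2) := by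
      have sq : ∀ m t : ℤ, 0 ≤ m → m ≤ t ∨ m ≤ -t → m ^ 2 ≤ t ^ 2 := fun m t hm h => by
        rw [sq_le_sq, abs_of_nonneg hm]
        exact le_abs.2 h
      have hcases : (W - 1 ≤ b.re ∨ W - 1 ≤ -b.re) ∨ (W - 1 ≤ b.im ∨ W - 1 ≤ -b.im) ∨
          (W' - 2 ≤ b.re + b.im ∨ W' - 2 ≤ -(b.re + b.im)) ∨
          (W' - 2 ≤ b.re - b.im ∨ W' - 2 ≤ -(b.re - b.im)) := by omega
      rcases hcases with h | h | h | h
      · left; nlinarith [sq _ _ (by omega) h]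
      · left; nlinarith [sq _ _ (by omega) h]
      · right; nlinarith [sq _ _ (by omega) h, sq_nonneg (b.re - b.im)]
      · right; nlinarith [sq _ _ (by omega) h, sq_nonneg (b.re + b.im)]
    rcases hW with ⟨rfl, rfl⟩ | ⟨rfl, rfl, -⟩ <;> rcases hlow with hlow | hlow <;> nlinarith

/-- A factor `1 + i` of `b` is cancelled together with one level; a factor of `d` costs a level,
regained because the levels are nested. -/
theorem mem_octagonTower_of_mul_mem {n : ℕ} {b d : GaussianInt} (hd : d ≠ 0)
    (h : b * d ∈ octagonTower n) : b ∈ octagonTower n := by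
  rcases eq_or_ne b 0 with rfl | hb
  · exact zero_mem_octagonTower n
  have hmul := mul_ne_zero hb hd
  induction n generalizing b d with
  | zero =>
    have hodd : IsOddGaussian (b * d) := (h.resolve_left hmul).1
    have ho := IsOddGaussian.mul_iff.1 hodd
    rw [ho.1.mem_octagonTower_iff]
    exact mem_octagon_of_mul_mem ho.2 (hodd.mem_octagonTower_iff.1 h)
  | succ n ih =>
    by_cases hd' : IsOddGaussian d
    · by_cases hb' : IsOddGaussian b
      · rw [hb'.mem_octagonTower_iff]
        rw [(IsOddGaussian.mul_iff.2 ⟨hb', hd'⟩).mem_octagonTower_iff] at h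
        exact mem_octagon_of_mul_mem hd' h
      · obtain ⟨c, rfl⟩ := exists_eq_onePlusI_mul hb'
        rw [mul_assoc, onePlusI_mul_mem_succ] at h
        rw [mul_assoc] at hmul
        exact onePlusI_mul_mem_succ.2
          (ih hd h (right_ne_zero_of_mul hb) (right_ne_zero_of_mul hmul))
    · obtain ⟨c, rfl⟩ := exists_eq_onePlusI_mul hd'
      rw [mul_left_comm, onePlusI_mul_mem_succ] at h
      exact octagonTower_subset_succ n (ih (right_ne_zero_of_mul hd) h hb
        (mul_ne_zero hb (right_ne_zero_of_mul hd)))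

/-- A Euclidean function takes values larger than `n` outside the `n`-th level of the tower. -/
theorem mem_octagonTower_of_isEuclideanFunction {f : GaussianInt → ℕ}
    (hf : IsEuclideanFunction f) {n : ℕ} {b : GaussianInt} (hb : f b ≤ n) :
    b ∈ octagonTower n := by
  induction n generalizing b with
  | zero =>
    rcases eq_or_ne b 0 with rfl | hb0
    · exact zero_mem_octagonTower 0
    obtain ⟨q, r, h, hr⟩ := hf 1 b hb0
    have hr0 : r = 0 := hr.resolve_right (by omega)
    rw [hr0, add_zero, mul_comm] at h
    refine mem_octagonTower_of_mul_mem (d := q) ?_ ?_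
    · rintro rfl
      simp at h
    · rw [← h]
      refine Or.inr ⟨by simp [IsOddGaussian], by simp [octagon, InOctagon, octagonSize]⟩
  | succ n ih =>
    rcases eq_or_ne b 0 with rfl | hb0
    · exact zero_mem_octagonTower _
    obtain ⟨q, r, h, hr⟩ := hf (onePlusI ^ (n + 1)) b hb0
    have hr' : r ∈ octagonTower n := by
      rcases hr with rfl | hr
      · exact zero_mem_octagonTower n
      · exact ih (by omega)
    refine mem_octagonTower_of_mul_mem (d := q) ?_ ?_
    · rintro rfl
      rw [zero_mul, zero_add] at h
      exact onePlusI_pow_not_mem n (h ▸ hr')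
    · rw [show b * q = onePlusI ^ (n + 1) - r by rw [h]; ring]
      exact onePlusI_pow_sub_mem hr'

/-! ### The level function is Euclidean -/

theorem exists_eq_mul_of_mem_octagonTower_zero (a : GaussianInt) {b : GaussianInt} (hb0 : b ≠ 0)
    (hb : b ∈ octagonTower 0) : ∃ q, a = q * b := by
  obtain ⟨hodd, h⟩ := hb.resolve_left hb0
  simp only [octagon, InOctagon, octagonSize, Set.mem_ofPred_eq] at h
  refine ⟨a * star b, ?_⟩
  have hn : b.norm = 1 := by
    rw [Zsqrtd.norm_def]
    unfold IsOddGaussian at hodd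
    generalize b.re = u at *
    generalize b.im = v at *
    have h1 : -1 ≤ u ∧ u ≤ 1 ∧ -1 ≤ v ∧ v ≤ 1 := by omega
    obtain ⟨h1, h2, h3, h4⟩ := h1
    interval_cases u <;> interval_cases v <;> omega
  have := Zsqrtd.norm_eq_mul_conj b
  rw [hn, Int.cast_one] at this
  rw [mul_assoc, mul_comm (star b), ← this, mul_one]

theorem exists_isShort (a b : GaussianInt) :
    ∃ q r, a = q * b + r ∧ IsShort b.re b.im r.re r.im := by
  let f : GaussianInt → ℕ := fun q => (a - q * b).norm.natAbs
  obtain ⟨q, hq⟩ : ∃ q, ∀ q', f q ≤ f q' :=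
    ⟨Function.argmin f, fun q' => Function.argmin_le f q'⟩
  have hmin : ∀ u, (a - q * b).norm ≤ (a - q * b - u * b).norm := by
    intro u
    have := hq (q + u)
    rw [show a - q * b - u * b = a - (q + u) * b by ring]
    have h1 := GaussianInt.norm_nonneg (a - q * b)
    have h2 := GaussianInt.norm_nonneg (a - (q + u) * b)
    simp only [f] at this
    omega
  refine ⟨q, a - q * b, by ring, ?_⟩
  generalize a - q * b = r at hmin
  have h1 := hmin 1
  have h2 := hmin (-1)
  have h3 := hmin ⟨0, 1⟩
  have h4 := hmin ⟨0, -1⟩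
  simp [Zsqrtd.norm_def] at h1 h2 h3 h4
  refine ⟨?_, ?_, ?_, ?_⟩ <;> nlinarith

/-- Every residue class modulo an element of level `n + 1` meets the `n`-th level. -/
theorem exists_rem_mem_octagonTower {n : ℕ} (a : GaussianInt) {b : GaussianInt} (hb0 : b ≠ 0)
    (hb : b ∈ octagonTower (n + 1)) : ∃ q r, a = q * b + r ∧ r ∈ octagonTower n := by
  have key : ∀ (n : ℕ) (a b : GaussianInt), b ∈ octagonTower (n + 1) → IsOddGaussian b →
      ∃ q r, a = q * b + r ∧ r ∈ octagonTower n := by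
    intro n a b hb hodd
    obtain ⟨q, r, rfl, hr⟩ := exists_isShort a b
    by_cases hmem : r ∈ octagonTower n
    · exact ⟨q, r, rfl, hmem⟩
    have heven : r ∈ octagon n → ¬ IsOddGaussian r := fun h h' =>
      hmem (h'.mem_octagonTower_iff.2 h)
    rw [hodd.mem_octagonTower_iff] at hb
    obtain ⟨J, hJ, hJD, hre, him, hbad⟩ := exists_dvd_not_inOctagon hmem
    obtain ⟨he, hnb⟩ := hasNeighbour_of_isShort hJ hJD hre him hb hodd
      (fun h => by have : ¬ IsOddGaussian r := heven h; unfold IsOddGaussian at this; omega)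
      hr hbad
    -- Subtracting an odd multiple of the odd `b` makes the even `r` odd, and for odd numbers lying
    -- in the octagon suffices.
    have hshift : ∀ u : GaussianInt, IsOddGaussian u → r - u * b ∈ octagon n →
        ∃ q' r', q * b + r = q' * b + r' ∧ r' ∈ octagonTower n := by
      intro u hu h
      refine ⟨q + u, r - u * b, by ring, (IsOddGaussian.mem_octagonTower_iff ?_).2 h⟩
      have := IsOddGaussian.mul_iff.2 ⟨hu, hodd⟩
      unfold IsOddGaussian at this ⊢
      rw [Zsqrtd.re_sub, Zsqrtd.im_sub]
      omega
    rcases hnb with h | h | h | h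
    · refine hshift 1 (by simp [IsOddGaussian]) ?_
      simpa [octagon] using h
    · refine hshift ⟨0, 1⟩ (by simp [IsOddGaussian]) ?_
      simpa [octagon] using h
    · refine hshift (-1) (by simp [IsOddGaussian]) ?_
      simpa [octagon] using h
    · refine hshift ⟨0, -1⟩ (by simp [IsOddGaussian]) ?_
      simpa [octagon, ← sub_eq_add_neg] using h
  induction n generalizing a b with
  | zero =>
    by_cases hodd : IsOddGaussian b
    · exact key 0 a b hb hodd
    obtain ⟨c, rfl⟩ := exists_eq_onePlusI_mul hodd
    rw [onePlusI_mul_mem_succ] at hb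
    have hc0 := right_ne_zero_of_mul hb0
    by_cases ha : IsOddGaussian a
    · have ha' : ¬ IsOddGaussian (a - 1) := by
        unfold IsOddGaussian at ha ⊢
        simp only [Zsqrtd.re_sub, Zsqrtd.im_sub, Zsqrtd.re_one, Zsqrtd.im_one]
        omega
      obtain ⟨a', h'⟩ := exists_eq_onePlusI_mul ha'
      obtain ⟨q, rfl⟩ := exists_eq_mul_of_mem_octagonTower_zero a' hc0 hb
      exact ⟨q, 1, by linear_combination h',
        Or.inr ⟨by simp [IsOddGaussian], by simp [octagon, InOctagon, octagonSize]⟩⟩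
    · obtain ⟨a', rfl⟩ := exists_eq_onePlusI_mul ha
      obtain ⟨q, rfl⟩ := exists_eq_mul_of_mem_octagonTower_zero a' hc0 hb
      exact ⟨q, 0, by ring, zero_mem_octagonTower 0⟩
  | succ n ih =>
    by_cases hodd : IsOddGaussian b
    · exact key _ a b hb hodd
    obtain ⟨c, rfl⟩ := exists_eq_onePlusI_mul hodd
    rw [onePlusI_mul_mem_succ] at hb
    have hc0 := right_ne_zero_of_mul hb0
    by_cases ha : IsOddGaussian a
    · have ha' : ¬ IsOddGaussian (a - 1) := by
        unfold IsOddGaussian at ha ⊢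
        simp only [Zsqrtd.re_sub, Zsqrtd.im_sub, Zsqrtd.re_one, Zsqrtd.im_one]
        omega
      obtain ⟨a', h'⟩ := exists_eq_onePlusI_mul ha'
      obtain ⟨q, r, rfl, hr⟩ := ih a' hc0 hb
      -- This remainder is odd, so only membership in the octagon is needed.
      refine ⟨q, onePlusI * r + 1, by linear_combination h', ?_⟩
      refine (IsOddGaussian.mem_octagonTower_iff ?_).2
        (onePlusI_mul_add_mem_octagon (octagonTower_subset_octagon n hr) (by simp [InOctagon]))
      have := onePlusI_mul_not_isOdd r
      unfold IsOddGaussian at this ⊢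
      simp only [Zsqrtd.re_add, Zsqrtd.im_add, Zsqrtd.re_one, Zsqrtd.im_one]
      omega
    · obtain ⟨a', rfl⟩ := exists_eq_onePlusI_mul ha
      obtain ⟨q, r, rfl, hr⟩ := ih a' hc0 hb
      exact ⟨q, onePlusI * r, by ring, onePlusI_mul_mem_succ.2 hr⟩

theorem minimalEuclideanFunction_le_iff {n : ℕ} {x : GaussianInt} :
    minimalEuclideanFunction GaussianInt x ≤ n ↔ x ∈ octagonTower n := by
  classical
  let g : GaussianInt → ℕ := fun x => Nat.find (exists_mem_octagonTower x)
  have hg_mem : ∀ x, x ∈ octagonTower (g x) := fun x => Nat.find_spec (exists_mem_octagonTower x)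
  have hg_le : ∀ x m, x ∈ octagonTower m → g x ≤ m := fun x m h =>
    Nat.find_min' (exists_mem_octagonTower x) h
  have hg : IsEuclideanFunction g := by
    intro a b hb
    have hmem := hg_mem b
    rcases hn : g b with _ | m
    · rw [hn] at hmem
      obtain ⟨q, h⟩ := exists_eq_mul_of_mem_octagonTower_zero a hb hmem
      exact ⟨q, 0, by rw [h, add_zero], Or.inl rfl⟩
    · rw [hn] at hmem
      obtain ⟨q, r, h, hr⟩ := exists_rem_mem_octagonTower a hb hmem
      exact ⟨q, r, h, Or.inr (by have := hg_le r m hr; omega)⟩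
  constructor
  · intro h
    obtain ⟨f, hf, hfx⟩ : minimalEuclideanFunction GaussianInt x ∈
        {n : ℕ | ∃ f : GaussianInt → ℕ, IsEuclideanFunction f ∧ f x = n} :=
      Nat.sInf_mem ⟨g x, g, hg, rfl⟩
    exact mem_octagonTower_of_isEuclideanFunction hf (hfx.trans_le h)
  · intro h
    unfold minimalEuclideanFunction
    exact (Nat.sInf_le (Exists.intro g ⟨hg, rfl⟩)).trans (hg_le x n h)

/-! ### Counting odd points and summing over levels -/

/-- If `b` is the largest integer at most `B` of the parity opposite to that of `x`, then there are
`b + 1` integers `y` with `|y| ≤ B` and `x + y` odd. -/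
theorem card_filter_Icc_parity (x b B : ℤ) (hb : 0 ≤ b + 1) (hbB : b = B ∨ b + 1 = B)
    (h : (x + b) % 2 = 1) :
    (((Finset.Icc (-B) B).filter fun y => (x + y) % 2 = 1).card : ℤ) = b + 1 := by
  have : (Finset.Icc (-B) B).filter (fun y => (x + y) % 2 = 1) =
      (Finset.range (b + 1).toNat).image fun t : ℕ => -b + 2 * (t : ℤ) := by
    ext y
    simp only [Finset.mem_filter, Finset.mem_Icc, Finset.mem_image, Finset.mem_range]
    constructor
    · intro hy
      exact ⟨((y + b) / 2).toNat, by omega, by omega⟩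
    · rintro ⟨t, ht, rfl⟩
      omega
  rw [this, Finset.card_image_of_injective, Finset.card_range]
  · omega
  · intro s t hst
    simpa using hst

/-- The odd points of an octagon, as a finite set of pairs of integers. -/
noncomputable def oddOctagonPairs (M S : ℤ) : Finset (ℤ × ℤ) :=
  (Finset.Icc (-M) M).sigma (fun x => (Finset.Icc (-min M (S - |x|)) (min M (S - |x|))).filter
    fun y => (x + y) % 2 = 1) |>.map (Equiv.sigmaEquivProd ℤ ℤ).toEmbedding

theorem mem_oddOctagonPairs {M S : ℤ} {z : ℤ × ℤ} :
    z ∈ oddOctagonPairs M S ↔ InOctagon M S z.1 z.2 ∧ (z.1 + z.2) % 2 = 1 := by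
  obtain ⟨x, y⟩ := z
  have : ((x, y) ∈ oddOctagonPairs M S) ↔
      ((-M ≤ x ∧ x ≤ M) ∧ (-min M (S - |x|) ≤ y ∧ y ≤ min M (S - |x|)) ∧ (x + y) % 2 = 1) := by
    simp [oddOctagonPairs]
  rw [this, ← and_assoc]
  refine and_congr_left fun _ => ?_
  unfold InOctagon
  rcases abs_cases x with ⟨h, _⟩ | ⟨h, _⟩ <;> rw [h] <;> omega

theorem sum_Icc_neg_of_even (g : ℤ → ℤ) (hg : ∀ x, g (-x) = g x) (m : ℕ) :
    ∑ x ∈ Finset.Icc (-(m : ℤ)) m, g x = g 0 + 2 * ∑ i ∈ Finset.range m, g (i + 1) := by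
  induction m with
  | zero => simp
  | succ m ih =>
    have h : Finset.Icc (-((m + 1 : ℕ) : ℤ)) ((m + 1 : ℕ) : ℤ) =
        insert (-(m + 1 : ℤ)) (insert (m + 1 : ℤ) (Finset.Icc (-(m : ℤ)) m)) := by
      ext x
      simp only [Finset.mem_insert, Finset.mem_Icc]
      omega
    rw [h, Finset.sum_insert, Finset.sum_insert, ih, Finset.sum_range_succ, hg]
    · ring
    · simp
    · simp only [Finset.mem_insert, Finset.mem_Icc]
      omega

/-- The number of odd points of the octagon with `A = a + t` and `B = 2 a + t`, for odd `a`, `t`. -/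
theorem card_oddOctagonPairs {a t : ℕ} (ha : a % 2 = 1) (ht : t % 2 = 1) :
    ((oddOctagonPairs (a + t) (2 * a + t)).card : ℤ) =
      (2 * a + 1) * (a + t) + (a + 1) + t * (2 * a + t + 1) := by
  -- `g x` counts the odd points with first coordinate `x`; the octagon's slanted sides begin at
  -- `|x| = B - A = a`.
  let g : ℤ → ℤ := fun x => if |x| ≤ a then a + t + x % 2 else 2 * a + t + 1 - |x|
  have hrow : ∀ x ∈ Finset.Icc (-(a + t : ℤ)) (a + t),
      (((Finset.Icc (-min (a + t : ℤ) (2 * a + t - |x|)) (min (a + t : ℤ) (2 * a + t - |x|))).filter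
        fun y => (x + y) % 2 = 1).card : ℤ) = g x := by
    intro x hx
    rw [Finset.mem_Icc] at hx
    have habs : |x| % 2 = x % 2 ∧ |x| ≤ a + t := by
      rcases abs_cases x with h | h <;> omega
    simp only [g]
    split_ifs with h
    · rw [min_eq_left (by omega)]
      rcases Int.emod_two_eq_zero_or_one x with h0 | h0
      · rw [card_filter_Icc_parity x (a + t - 1) _ (by omega) (by omega) (by omega), h0]
        ring
      · rw [card_filter_Icc_parity x (a + t) _ (by omega) (by omega) (by omega), h0]
    · rw [min_eq_right (by omega),
        card_filter_Icc_parity x (2 * a + t - |x|) _ (by omega) (by omega) (by omega)]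
      ring
  have hg : ∀ x, g (-x) = g x := fun x => by
    simp only [g, abs_neg]
    rw [show -x % 2 = x % 2 by omega]
  have hsum := sum_Icc_neg_of_even g hg (a + t)
  have hfst : ∀ m ≤ a, 2 * ∑ i ∈ Finset.range m, g (i + 1) = 2 * m * (a + t) + m + m % 2 := by
    intro m hm
    induction m with
    | zero => simp
    | succ m ih =>
      rw [Finset.sum_range_succ, mul_add, ih (by omega)]
      have : g (m + 1) = a + t + (m + 1) % 2 := by
        simp only [g]
        rw [abs_of_nonneg (by omega), if_pos (by omega)]
      rw [this]
      push_cast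
      have : (m : ℤ) % 2 + ((m : ℤ) + 1) % 2 = 1 := by omega
      linear_combination this
  have hsnd : ∀ m : ℕ, 2 * ∑ i ∈ Finset.range m, g ((a + i : ℕ) + 1) =
      m * (2 * a + 2 * t - m + 1) := by
    intro m
    induction m with
    | zero => simp
    | succ m ih =>
      rw [Finset.sum_range_succ, mul_add, ih]
      have : g ((a + m : ℕ) + 1) = a + t - m := by
        simp only [g]
        rw [abs_of_nonneg (by omega), if_neg (by omega)]
        push_cast
        ring
      rw [this]
      push_cast
      ring
  have hg0 : g 0 = a + t := by simp [g]
  rw [oddOctagonPairs, Finset.card_map, Finset.card_sigma, Nat.cast_sum, Finset.sum_congr rfl hrow]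
  rw [Finset.sum_range_add, mul_add, hfst a le_rfl, hsnd t, hg0] at hsum
  push_cast at hsum
  rw [hsum, show (a : ℤ) % 2 = 1 by omega]
  ring

/-- The odd points of the `n`-th octagon are finite in number. -/
theorem ncard_oddOctagon (n : ℕ) :
    {z | IsOddGaussian z ∧ z ∈ octagon n}.Finite ∧
      {z | IsOddGaussian z ∧ z ∈ octagon n}.ncard =
        (oddOctagonPairs (octagonSize n - 2) (octagonSize (n + 1) - 3)).card := by
  have hset : {z | IsOddGaussian z ∧ z ∈ octagon n} =
      (fun p : ℤ × ℤ => (⟨p.1, p.2⟩ : GaussianInt)) ''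
        (oddOctagonPairs (octagonSize n - 2) (octagonSize (n + 1) - 3)) := by
    ext z
    simp only [Set.mem_ofPred_eq, Set.mem_image, SetLike.mem_coe, mem_oddOctagonPairs]
    constructor
    · rintro ⟨h, h'⟩
      exact ⟨(z.re, z.im), ⟨h', h⟩, rfl⟩
    · rintro ⟨p, ⟨h, h'⟩, rfl⟩
      exact ⟨h', h⟩
  have hinj : Function.Injective (fun p : ℤ × ℤ => (⟨p.1, p.2⟩ : GaussianInt)) := by
    intro p q h
    exact Prod.ext (congrArg Zsqrtd.re h) (congrArg Zsqrtd.im h)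
  rw [hset]
  exact ⟨(Finset.finite_toSet _).image _, by
    rw [Set.ncard_image_of_injective _ hinj, Set.ncard_coe_finset]⟩

theorem octagonTower_finite (n : ℕ) : (octagonTower n).Finite := by
  induction n with
  | zero => exact (ncard_oddOctagon 0).1.insert 0
  | succ n ih => exact (ncard_oddOctagon (n + 1)).1.union (ih.image _)

theorem ncard_octagonTower_zero : (octagonTower 0).ncard = 5 := by
  rw [octagonTower, Set.ncard_insert_of_notMem (fun h => zero_not_isOdd h.1)
    (ncard_oddOctagon 0).1, (ncard_oddOctagon 0).2]
  decide

/-- Both `a = w (n+2) - w (n+1) - 1` and `t = 2 w (n+1) - w (n+2) - 1` are odd because all sizes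
except `w 0 = 3` are even. -/
theorem ncard_octagonTower_succ {n a t : ℕ} (ha : a % 2 = 1) (ht : t % 2 = 1)
    (h : octagonSize (n + 1) = a + t + 2) (h' : octagonSize (n + 1 + 1) = 2 * a + t + 3) :
    ((octagonTower (n + 1)).ncard : ℤ) =
      (2 * a + 1) * (a + t) + (a + 1) + t * (2 * a + t + 1) + (octagonTower n).ncard := by
  rw [octagonTower, Set.ncard_union_eq ?_ (ncard_oddOctagon _).1 ((octagonTower_finite n).image _),
    (ncard_oddOctagon _).2, Set.ncard_image_of_injective _ (mul_right_injective₀ onePlusI_ne_zero),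
    h, h', add_sub_cancel_right, add_sub_cancel_right, Nat.cast_add, card_oddOctagonPairs ha ht]
  rw [Set.disjoint_left]
  rintro z hz ⟨y, -, rfl⟩
  exact onePlusI_mul_not_isOdd y hz.1

theorem octagonSize_two_mul (k : ℕ) :
    octagonSize (2 * k) = 3 * 2 ^ k ∧ octagonSize (2 * k + 1) = 4 * 2 ^ k := by
  induction k with
  | zero => exact ⟨rfl, rfl⟩
  | succ k ih =>
    have h2 := octagonSize_add_two (2 * k)
    have h3 := octagonSize_add_two (2 * k + 1)
    rw [mul_add, pow_succ]
    constructor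
    · rw [show 2 * k + 2 * 1 = 2 * k + 1 + 1 from rfl, h2, ih.1]; ring
    · rw [show 2 * k + 2 * 1 + 1 = 2 * k + 1 + 1 + 1 from rfl, h3, ih.2]; ring

theorem ncard_octagonTower_odd (k : ℕ) : ((octagonTower (2 * k + 1)).ncard : ℤ) =
    29 + 8 * (k : ℤ) - 68 * 2 ^ k + 56 * 4 ^ k := by
  induction k with
  | zero =>
    rw [ncard_octagonTower_succ (n := 0) (a := 1) (t := 1) rfl rfl rfl rfl,
      ncard_octagonTower_zero]
    norm_num
  | succ k ih =>
    -- The parameters for the next two levels are `2 ^ (k+1) - 1` and `2 ^ (k+2) - 1`; writing `2 ^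
    -- k = a + 1` avoids truncated subtraction.
    obtain ⟨a, ha⟩ : ∃ a, a + 1 = 2 ^ k := ⟨2 ^ k - 1, Nat.sub_add_cancel Nat.one_le_two_pow⟩
    have ha' : (2 : ℤ) ^ k = a + 1 := by exact_mod_cast ha.symm
    have h1 := octagonSize_two_mul (k + 1)
    have h2 := octagonSize_two_mul (k + 1 + 1)
    rw [pow_succ, pow_succ, ha'] at h2
    rw [pow_succ, ha'] at h1
    rw [show 2 * (k + 1) + 1 = 2 * k + 1 + 1 + 1 from rfl,
      ncard_octagonTower_succ (n := 2 * k + 1 + 1) (a := 4 * a + 3) (t := 4 * a + 3)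
        (by omega) (by omega)
        (by rw [← show 2 * (k + 1) + 1 = 2 * k + 1 + 1 + 1 from rfl, h1.2]; push_cast; ring)
        (by rw [← show 2 * (k + 1 + 1) = 2 * k + 1 + 1 + 1 + 1 from rfl, h2.1]; push_cast; ring),
      ncard_octagonTower_succ (n := 2 * k + 1) (a := 2 * a + 1) (t := 4 * a + 3)
        (by omega) (by omega)
        (by rw [← show 2 * (k + 1) = 2 * k + 1 + 1 from rfl, h1.1]; push_cast; ring)
        (by rw [← show 2 * (k + 1) + 1 = 2 * k + 1 + 1 + 1 from rfl, h1.2]; push_cast; ring), ih]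
    have h4 : (4 : ℤ) ^ k = (a + 1) ^ 2 := by
      rw [← ha', ← pow_mul, mul_comm, pow_mul]; norm_num
    rw [pow_succ, pow_succ, h4, ha']
    push_cast
    ring

/-- `ncard` vanishes on infinite sets, so the positive right-hand side also expresses finiteness. -/
theorem mainTheorem2 (k : ℕ) (hk : 1 ≤ k) :
    ((minimalEuclideanFunction GaussianInt ⁻¹' Set.Icc 0 (2 * k + 1)).ncard : ℤ) =
      29 + 8 * (k : ℤ) - 68 * 2 ^ k + 56 * 4 ^ k := by
  have : minimalEuclideanFunction GaussianInt ⁻¹' Set.Icc 0 (2 * k + 1) =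
      octagonTower (2 * k + 1) := by
    ext x
    rw [Set.mem_preimage, Set.mem_Icc, minimalEuclideanFunction_le_iff]
    exact and_iff_right (Nat.zero_le _)
  rw [this, ncard_octagonTower_odd]
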